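/- Let $k\ge 2$ and $s\ge 2$ be integers and let $\delta>0$. Then there exists $\gamma=\gamma(k,s,\delta)>0$ such that the following holds for all sufficiently large $n$ (in terms of $k,s,\delta$). Let $G$ be a $k$-uniform hypergraph on $n$ vertices with $e(G)$ edges such that $\min\{e(G),\binom nk-e(G)\}\ge\delta n^k$, and let $W$ be a family of $k$-element subsets of $V(G)$ with $|W|\le\gamma n^k$. Then $G$ has an induced subhypergraph $F$ which is a non-homogeneous $(k,k,s)$-pattern and which avoids $W$, that is, no $k$-element subset of $V(F)$ (edge or non-edge) belongs to $W$. Here, for integers $k,t\ge 2$ and $s$, a $(k,t,s)$-pattern is a $k$-uniform hypergraph $F$ admitting a partition $V(F)=V_1\cup\dots\cup V_t$ into parts of size $s$ such that, for every $k$-element subset $S$ of $V(F)$, whether $S$ is an edge of $F$ depends only on $(|S\cap V_1|,\dots,|S\cap V_t|)$. A $k$-uniform hypergraph is homogeneous if it is empty (no edges) or complete (every $k$-element subset of its vertex set is an edge), and an induced subhypergraph of $G$ on $U\subseteq V(G)$ has as edges exactly the edges of $G$ contained in $U$. -/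

import Mathlib

namespace Hypergraph

/-- The family of all `k`-element subsets of a set `X`. -/
def kSubsets {α : Type*} (X : Set α) (k : ℕ) : Set (Set α) :=
  {e | e ⊆ X ∧ e.encard = k}

/-- A hypergraph is `k`-uniform if each of its edges has exactly `k` elements. -/
def IsUniform {α : Type*} (H : Hypergraph α) (k : ℕ) : Prop :=
  ∀ e ∈ H.edgeSet, e.encard = k

/-- `F` is an induced subhypergraph of `G`: its vertices are vertices of `G`, and its edges are
exactly the edges of `G` that are contained in its vertex set. -/
def IsInducedSubhypergraph {α : Type*} (F G : Hypergraph α) : Prop :=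
  F.vertexSet ⊆ G.vertexSet ∧ F.edgeSet = {e | e ∈ G.edgeSet ∧ e ⊆ F.vertexSet}

/-- A `(k, t, s)`-pattern: a `k`-uniform hypergraph whose vertex set has a partition into `t` parts
of size `s` such that whether a `k`-subset `S` of the vertex set is an edge depends only on the
sizes of the intersections of `S` with the parts. -/
def IsPattern {α : Type*} (F : Hypergraph α) (k t s : ℕ) : Prop :=
  2 ≤ k ∧ 2 ≤ t ∧ F.IsUniform k ∧
    ∃ P : Fin t → Set α,
      (∀ i, (P i).encard = s) ∧
      (∀ i j, i ≠ j → Disjoint (P i) (P j)) ∧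
      F.vertexSet = ⋃ i, P i ∧
      ∀ S ∈ kSubsets F.vertexSet k, ∀ T ∈ kSubsets F.vertexSet k,
        (∀ i, (S ∩ P i).encard = (T ∩ P i).encard) → (S ∈ F.edgeSet ↔ T ∈ F.edgeSet)

/-- A `k`-uniform hypergraph is homogeneous if it is empty (it has no edges) or complete (every
`k`-subset of its vertex set is an edge). -/
def IsHomogeneous {α : Type*} (F : Hypergraph α) (k : ℕ) : Prop :=
  F.edgeSet = ∅ ∨ F.edgeSet = kSubsets F.vertexSet k

/-- `F` avoids a family `W` of `k`-sets if no `k`-subset of the vertex set of `F`, whether it is an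
edge or a non-edge of `F`, belongs to `W`. -/
def Avoids {α : Type*} (F : Hypergraph α) (k : ℕ) (W : Set (Set α)) : Prop :=
  Disjoint (kSubsets F.vertexSet k) W

end Hypergraph

/-! Work with ordered `k`-tuples of vertices, repetitions allowed. The tuples enumerating edges form
a symmetric set `A`, and `A` and its complement both have density at least `δ`. Passing from a tuple
in `A` to one outside it coordinate by coordinate shows that a positive proportion of `(k +
1)`-tuples are switching: deleting entry 1 gives a member of `A`, deleting entry 0 a non-member. By
supersaturation (`card_blowups_ge`), a positive proportion of arrays of `k + 1` blocks of size `M`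
have only switching transversals. Few arrays repeat a vertex (`n` large) or contain a member of `W`
(`γ` small), so some array does neither (`exists_injective_blowup`).

Ramsey's theorem shrinks its blocks to size `s` so that being an edge depends only on intersection
sizes (`exists_profile_blocks`). Deleting any one block leaves a `(k, k, s)`-pattern. Without block
1 there is an edge, without block 0 a non-edge. Were both patterns homogeneous, the first would be
complete and the second empty, yet they share `k - 1` blocks, which contain a `k`-set because `(k -
1) * s ≥ k`. -/

/-! ### Ramsey's theorem -/

/-- The finite Ramsey theorem for finite colourings of the `k`-subsets of a finite set. -/
theorem finite_ramsey (C : Type*) [Finite C] (k : ℕ) : ∀ m : ℕ, ∃ N : ℕ,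
    ∀ (c : Finset ℕ → C) (X : Finset ℕ), N ≤ X.card →
      ∃ Y ⊆ X, Y.card = m ∧ ∃ d : C, ∀ S ⊆ Y, S.card = k → c S = d := by
  classical
  cases nonempty_fintype C
  induction k with
  | zero =>
    intro m
    refine ⟨m, fun c X hX => ?_⟩
    obtain ⟨Y, hY, hm⟩ := Finset.exists_subset_card_eq hX
    refine ⟨Y, hY, hm, c ∅, fun S _ hS => ?_⟩
    rw [Finset.card_eq_zero.1 hS]
  | succ k ih =>
    -- Extracting minima repeatedly makes the colour of a `(k + 1)`-set depend only on its least
    -- element. The case `L = 0` is separate because `C` may be empty, and then no `d` exists.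
    have key : ∀ L : ℕ, ∃ N : ℕ, ∀ (c : Finset ℕ → C) (X : Finset ℕ), N ≤ X.card →
        ∃ Y ⊆ X, Y.card = L ∧ (L = 0 ∨ ∃ d : ℕ → C, ∀ x ∈ Y, ∀ S ⊆ Y, S.card = k →
          (∀ y ∈ S, x < y) → c (insert x S) = d x) := by
      intro L
      induction L with
      | zero => exact ⟨0, fun c X _ => ⟨∅, by simp, by simp, Or.inl rfl⟩⟩
      | succ L ihL =>
        obtain ⟨N, hN⟩ := ihL
        obtain ⟨R, hR⟩ := ih N
        refine ⟨R + 1, fun c X hX => ?_⟩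
        have hne : X.Nonempty := Finset.card_pos.1 (by omega)
        set x := X.min' hne with hx
        have hxX : x ∈ X := X.min'_mem hne
        obtain ⟨Y, hY, hYc, d₀, hd₀⟩ := hR (fun S => c (insert x S)) (X.erase x)
          (by rw [Finset.card_erase_of_mem hxX]; omega)
        obtain ⟨Z, hZ, hZc, hd⟩ := hN c Y hYc.ge
        have hxZ : x ∉ Z := fun h => by simpa using hY (hZ h)
        have hlt : ∀ z ∈ Z, x < z := fun z hz => by
          have := Finset.mem_erase.1 (hY (hZ hz))
          exact lt_of_le_of_ne (X.min'_le z this.2) (Ne.symm this.1)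
        refine ⟨insert x Z, Finset.insert_subset hxX
          ((hZ.trans hY).trans (Finset.erase_subset _ _)),
          by rw [Finset.card_insert_of_notMem hxZ, hZc], Or.inr ?_⟩
        have hd' : ∃ d : ℕ → C, ∀ x ∈ Z, ∀ S ⊆ Z, S.card = k →
            (∀ y ∈ S, x < y) → c (insert x S) = d x := by
          rcases hd with h0 | h
          · subst h0
            rw [Finset.card_eq_zero] at hZc
            subst hZc
            exact ⟨fun _ => d₀, by simp⟩
          · exact h
        obtain ⟨d, hd⟩ := hd'
        refine ⟨Function.update d x d₀, fun z hz S hS hSc hzS => ?_⟩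
        have hxz : x ≤ z := by
          rcases Finset.mem_insert.1 hz with rfl | h
          · exact le_rfl
          · exact (hlt z h).le
        have hSZ : S ⊆ Z := fun y hy => by
          rcases Finset.mem_insert.1 (hS hy) with h | h
          · have := hzS y hy
            omega
          · exact h
        rcases Finset.mem_insert.1 hz with h | h
        · subst h
          simpa using hd₀ S (hSZ.trans hZ) hSc
        · rw [Function.update_of_ne (hlt z h).ne']
          exact hd z h S hSZ hSc hzS
    intro m
    -- Pigeonhole on `d` needs `card C * m` points; the extra one excludes the case `L = 0`.
    obtain ⟨N, hN⟩ := key (Fintype.card C * m + 1)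
    refine ⟨N, fun c X hX => ?_⟩
    obtain ⟨Y, hY, hYc, h0 | ⟨d, hd⟩⟩ := hN c X hX
    · omega
    have : (Finset.univ : Finset C).Nonempty := ⟨d 0, Finset.mem_univ _⟩
    obtain ⟨a, -, ha⟩ := Finset.exists_le_card_fiber_of_mul_le_card_of_maps_to
      (s := Y) (t := Finset.univ) (f := d) (n := m) (fun _ _ => Finset.mem_univ _) this
      (by rw [Finset.card_univ]; omega)
    obtain ⟨Z, hZ, hZc⟩ := Finset.exists_subset_card_eq ha
    refine ⟨Z, fun z hz => hY (Finset.mem_filter.1 (hZ hz)).1, hZc, a, fun S hS hSc => ?_⟩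
    have hne : S.Nonempty := Finset.card_pos.1 (by omega)
    have hmem := S.min'_mem hne
    have h1 := hd (S.min' hne) (Finset.mem_filter.1 (hZ (hS hmem))).1 (S.erase (S.min' hne))
      (fun y hy => (Finset.mem_filter.1 (hZ (hS (Finset.mem_of_mem_erase hy)))).1)
      (by rw [Finset.card_erase_of_mem hmem]; omega)
      (fun y hy => lt_of_le_of_ne (S.min'_le y (Finset.mem_of_mem_erase hy))
        (Ne.symm (Finset.ne_of_mem_erase hy)))
    rw [Finset.insert_erase hmem] at h1
    rw [h1, (Finset.mem_filter.1 (hZ (hS hmem))).2]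

/-- The finite Ramsey theorem in terms of order embeddings of initial segments. -/
theorem finite_ramsey_orderEmbedding (C : Type*) [Finite C] [Nonempty C] (k m : ℕ) : ∃ N : ℕ,
    ∀ c : (Fin k ↪o Fin N) → C, ∃ E : Fin m ↪o Fin N, ∃ d : C,
      ∀ u : Fin k ↪o Fin m, c (u.trans E) = d := by
  classical
  obtain ⟨N, hN⟩ := finite_ramsey C k m
  refine ⟨N, fun c => ?_⟩
  -- The arbitrary colour is given only to sets that are not the image of an embedding; it is never
  -- used.
  obtain ⟨Y, hY, hYc, d, hd⟩ := hN (fun S =>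
    if h : ∃ u : Fin k ↪o Fin N, Finset.univ.image (fun i => (u i : ℕ)) = S
    then c h.choose else Classical.arbitrary C) (Finset.range N) (by simp)
  let E : Fin m ↪o Fin N := OrderEmbedding.ofStrictMono
    (fun i => ⟨Y.orderEmbOfFin hYc i, Finset.mem_range.1 (hY (Y.orderEmbOfFin_mem hYc i))⟩)
    (fun i j hij => (Y.orderEmbOfFin hYc).strictMono hij)
  refine ⟨E, d, fun u => ?_⟩
  have hinj : ∀ v : Fin k ↪o Fin N, Function.Injective (fun i => (v i : ℕ)) :=
    fun v => Fin.val_injective.comp v.injective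
  have h := hd (Finset.univ.image (fun i => (u.trans E i : ℕ))) (fun y hy => by
      obtain ⟨i, -, rfl⟩ := Finset.mem_image.1 hy
      exact Y.orderEmbOfFin_mem hYc (u i))
    (by rw [Finset.card_image_of_injective _ (hinj _)]; simp)
  have hex : ∃ v : Fin k ↪o Fin N, Finset.univ.image (fun i => (v i : ℕ)) =
      Finset.univ.image (fun i => (u.trans E i : ℕ)) := ⟨_, rfl⟩
  rw [dif_pos hex] at h
  rw [← h]
  congr 1
  have hs := hex.choose_spec
  rw [← Finset.coe_inj, Finset.coe_image, Finset.coe_image, Finset.coe_univ, Set.image_univ,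
    Set.image_univ] at hs
  have h2 := (StrictMono.range_inj (f := fun i => (hex.choose i : ℕ))
    (g := fun i => (u.trans E i : ℕ)) (fun i j hij => hex.choose.strictMono hij)
    (fun i j hij => E.strictMono (u.strictMono hij))).1 hs
  ext i
  exact (congrFun h2 i).symm

/-! ### Supersaturation -/

/-- Power mean inequality, in the form: if the average of `f ≥ 0` over `ι` is at least `a`, then
the average of `f ^ N` is at least `a ^ N`. -/
theorem card_mul_pow_le_sum_pow {ι : Type*} [Fintype ι] (f : ι → ℝ) (hf : ∀ i, 0 ≤ f i)
    (a : ℝ) (ha : 0 ≤ a) (h : Fintype.card ι * a ≤ ∑ i, f i) (N : ℕ) :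
    Fintype.card ι * a ^ N ≤ ∑ i, f i ^ N := by
  rcases isEmpty_or_nonempty ι with hι | hι
  · simp
  have hc : (0 : ℝ) < Fintype.card ι := by exact_mod_cast Fintype.card_pos
  cases N with
  | zero => simp
  | succ N =>
    refine le_trans ?_ (pow_sum_div_card_le_sum_pow (s := Finset.univ) (f := f)
      (fun i _ => hf i) N)
    rw [le_div_iff₀ (by simpa using pow_pos hc N)]
    calc _ = (Fintype.card ι * a) ^ (N + 1) := by simp; ring
      _ ≤ _ := by gcongr

/-- Supersaturation of complete multipartite configurations: a subset of `V ^ r` of density `p`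
contains at least `p ^ (M ^ r) * |V| ^ (r * M)` boxes of side `M` (with repetitions). -/
theorem card_blowups_ge {V : Type*} [Fintype V] [Nonempty V] (M r : ℕ) :
    ∀ (T : Set (Fin r → V)) (p : ℝ), 0 ≤ p →
      p * (Fintype.card V : ℝ) ^ r ≤ (Nat.card T : ℝ) →
      p ^ (M ^ r) * (Fintype.card V : ℝ) ^ (r * M) ≤
        (Nat.card {φ : Fin r → Fin M → V | ∀ f : Fin r → Fin M, (fun i => φ i (f i)) ∈ T} : ℝ) := by
  classical
  induction r with
  | zero =>
    intro T p hp h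
    have : {φ : Fin 0 → Fin M → V | ∀ f : Fin 0 → Fin M, (fun i => φ i (f i)) ∈ T} =
      {φ | (fun i => i.elim0) ∈ T} := by
      ext φ
      simp only [Set.mem_ofPred_eq]
      constructor
      · intro h; convert h (fun i => i.elim0)
      · intro h f; convert h
    rw [this]
    by_cases hT : (fun i => i.elim0 : Fin 0 → V) ∈ T
    · have : T = Set.univ := by
        ext x; simp only [Set.mem_univ, iff_true]; convert hT
      subst this
      simpa using h
    · have : T = ∅ := by
        ext x; simp only [Set.mem_empty_iff_false, iff_false]; intro h; apply hT; convert h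
      subst this
      simpa using h
  | succ r ih =>
    intro T p hp h
    let n : ℝ := Fintype.card V
    have hpos : 0 < n := Nat.cast_pos.2 Fintype.card_pos
    -- sections of `T` and their intersections
    let D : (Fin r → V) → Set V := fun b => {a | Fin.cons a b ∈ T}
    let S : (Fin M → V) → Set (Fin r → V) := fun x => {b | ∀ j, x j ∈ D b}
    have hT : (Nat.card T : ℝ) = ∑ b, (Nat.card (D b) : ℝ) := by
      have e : T ≃ Σ b, D b :=
        { toFun := fun t => ⟨Fin.tail t.1, ⟨t.1 0, by simp [D]⟩⟩
          invFun := fun q => ⟨Fin.cons q.2.1 q.1, q.2.2⟩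
          left_inv := fun t => by simp
          right_inv := fun _ => rfl }
      rw [Nat.card_congr e, Nat.card_sigma]
      push_cast; rfl
    -- Double counting of pairs `(x, b)` with every `x j` in the section `D b`.
    have hS : ∑ x, (Nat.card (S x) : ℝ) = ∑ b, (Nat.card (D b) : ℝ) ^ M := by
      have e : (Σ x, S x) ≃ Σ b, (Fin M → D b) :=
        { toFun := fun q => ⟨q.2.1, fun j => ⟨q.1 j, q.2.2 j⟩⟩
          invFun := fun q => ⟨fun j => (q.2 j).1, ⟨q.1, fun j => (q.2 j).2⟩⟩
          left_inv := fun _ => rfl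
          right_inv := fun _ => rfl }
      have := Nat.card_congr e
      rw [Nat.card_sigma, Nat.card_sigma] at this
      simp only [Nat.card_fun, Nat.card_eq_fintype_card (α := Fin M), Fintype.card_fin] at this
      exact_mod_cast this
    have hB : (Nat.card {φ : Fin (r + 1) → Fin M → V |
          ∀ f : Fin (r + 1) → Fin M, (fun i => φ i (f i)) ∈ T} : ℝ) =
        ∑ x, (Nat.card {φ : Fin r → Fin M → V |
          ∀ f : Fin r → Fin M, (fun i => φ i (f i)) ∈ S x} : ℝ) := by
      have e : {φ : Fin (r + 1) → Fin M → V |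
          ∀ f : Fin (r + 1) → Fin M, (fun i => φ i (f i)) ∈ T} ≃
          Σ x, {φ : Fin r → Fin M → V | ∀ f : Fin r → Fin M, (fun i => φ i (f i)) ∈ S x} :=
        { toFun := fun φ => ⟨φ.1 0, ⟨Fin.tail φ.1, fun f j => by
            have := φ.2 (Fin.cons j f)
            change Fin.cons _ _ ∈ T
            convert this using 1
            ext i
            refine Fin.cases ?_ (fun i => ?_) i <;> simp [Fin.tail]⟩⟩
          invFun := fun q => ⟨Fin.cons q.1 q.2.1, fun f => by
            have := q.2.2 (Fin.tail f) (f 0)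
            change Fin.cons _ _ ∈ T at this
            convert this using 1
            ext i
            refine Fin.cases ?_ (fun i => ?_) i <;> simp [Fin.tail]⟩
          left_inv := fun t => by simp
          right_inv := fun _ => rfl }
      rw [Nat.card_congr e, Nat.card_sigma]
      push_cast; rfl
    have h1 : ((Fintype.card (Fin r → V) : ℕ) : ℝ) = n ^ r := by simp [n]
    -- The sections `D b` have average size at least `p * n`, so the power mean gives the `S x`
    -- average density at least `p ^ M`. A second power mean, with exponent `M ^ r`, prepares for
    -- induction on each `S x` at its own density.
    have h2 : n ^ r * (p * n) ^ M ≤ ∑ b, (Nat.card (D b) : ℝ) ^ M := by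
      rw [← h1]
      refine card_mul_pow_le_sum_pow _ (fun _ => Nat.cast_nonneg _) _ (by positivity) ?_ M
      rw [h1, ← hT]
      refine le_trans (le_of_eq ?_) h
      simp only [n]; ring
    have h3 : ((Fintype.card (Fin M → V) : ℕ) : ℝ) = n ^ M := by simp [n]
    have h4 : n ^ M * (p ^ M) ^ (M ^ r) ≤
        ∑ x, ((Nat.card (S x) : ℝ) / n ^ r) ^ (M ^ r) := by
      rw [← h3]
      refine card_mul_pow_le_sum_pow _ (fun _ => by positivity) _ (by positivity) ?_ _
      rw [h3, ← Finset.sum_div, le_div_iff₀ (by positivity), hS]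
      refine le_trans (le_of_eq ?_) h2
      ring
    rw [hB]
    calc _ = (n ^ M * (p ^ M) ^ (M ^ r)) * n ^ (r * M) := by
            simp only [n]; rw [← pow_mul, pow_succ' M r]; ring
      _ ≤ (∑ x, ((Nat.card (S x) : ℝ) / n ^ r) ^ (M ^ r)) * n ^ (r * M) := by gcongr
      _ = ∑ x, ((Nat.card (S x) : ℝ) / n ^ r) ^ (M ^ r) * n ^ (r * M) := Finset.sum_mul _ _ _
      _ ≤ _ := Finset.sum_le_sum fun x _ => ih (S x) _ (by positivity) (by
          rw [div_mul_cancel₀]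
          exact (pow_pos hpos r).ne')

/-! ### Switching tuples -/

/-- Two vertex tuples, one in `A` and the other not, can be joined by changing one coordinate at a
time, so one of the changes leaves `A`. -/
theorem exists_hybrid_leaving {V : Type*} {k : ℕ} (A : Set (Fin k → V)) (e f : Fin k → V)
    (he : e ∈ A) (hf : f ∉ A) :
    ∃ i : Fin k, (fun j => if j < i then f j else e j) ∈ A ∧
      Function.update (fun j => if j < i then f j else e j) i (f i) ∉ A := by
  by_contra! hcon
  have key : ∀ i : ℕ, i ≤ k → (fun j : Fin k => if (j : ℕ) < i then f j else e j) ∈ A := by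
    intro i
    induction i with
    | zero => intro _; simpa using he
    | succ i ih =>
      intro hi
      have h := hcon ⟨i, hi⟩ (by simpa [Fin.lt_def] using ih (by omega))
      convert h using 1
      ext j
      by_cases hj : j = ⟨i, hi⟩
      · subst hj; simp
      · have : (j : ℕ) ≠ i := fun h => hj (Fin.ext h)
        rw [Function.update_of_ne hj]
        simp only [Fin.lt_def]
        congr 1
        simp only [eq_iff_iff]
        omega
  exact hf (by simpa using key k le_rfl)

/-- Tuples whose first two entries distinguish members from non-members of `A`. -/
def switchingTuples {V : Type*} {m : ℕ} (A : Set (Fin (m + 1) → V)) : Set (Fin (m + 2) → V) :=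
  {t | (fun i => t (Fin.succAbove 1 i)) ∈ A ∧ (fun i => t (Fin.succAbove 0 i)) ∉ A}

/-- A symmetric set of tuples `A` has at least `|A| |Aᶜ| / ((m + 1) |V| ^ m)` switching tuples. -/
theorem card_mul_card_compl_le_switchingTuples {V : Type*} [Fintype V] {m : ℕ}
    (A : Set (Fin (m + 1) → V))
    (hA : ∀ (σ : Equiv.Perm (Fin (m + 1))) (x : Fin (m + 1) → V), x ∘ σ ∈ A ↔ x ∈ A) :
    Nat.card A * Nat.card (Aᶜ : Set (Fin (m + 1) → V)) ≤
      (m + 1) * (Nat.card (switchingTuples A) * Fintype.card V ^ m) := by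
  classical
  let P : Fin (m + 1) → Set ((Fin (m + 1) → V) × (Fin (m + 1) → V)) := fun i =>
    {q | q.1 ∈ A ∧ Function.update q.1 i (q.2 i) ∉ A}
  -- Send `(e, f)` to the hybrid that leaves `A` at `i` together with the complementary hybrid;
  -- given `i`, the two determine `e` and `f`.
  have h1 : Nat.card A * Nat.card (Aᶜ : Set (Fin (m + 1) → V)) ≤ ∑ i, Nat.card (P i) := by
    rw [← Nat.card_prod, ← Nat.card_sigma]
    choose I hI using fun q : A × (Aᶜ : Set (Fin (m + 1) → V)) =>
      exists_hybrid_leaving A q.1.1 q.2.1 q.1.2 q.2.2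
    refine Nat.card_le_card_of_injective (fun q => (⟨I q,
      ⟨(fun j => if j < I q then q.2.1 j else q.1.1 j,
        fun j => if j < I q then q.1.1 j else q.2.1 j), ?_⟩⟩ : Σ i, P i)) ?_
    · simpa [P] using hI q
    · intro q q' h
      simp only [Sigma.mk.injEq] at h
      obtain ⟨hi, h⟩ := h
      have h := (Subtype.heq_iff_coe_eq (fun x => by rw [hi])).1 h
      simp only [Prod.mk.injEq] at h
      rw [← hi] at h
      have h2 : ∀ j, q.1.1 j = q'.1.1 j ∧ q.2.1 j = q'.2.1 j := by
        intro j
        have e1 := congrFun h.1 j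
        have e2 := congrFun h.2 j
        by_cases hj : j < I q <;> simp only [hj, if_true, if_false] at e1 e2
        · exact ⟨e2, e1⟩
        · exact ⟨e1, e2⟩
      exact Prod.ext (Subtype.ext (funext fun j => (h2 j).1))
        (Subtype.ext (funext fun j => (h2 j).2))
  -- Symmetry of `A` moves the changed coordinate to position 0.
  have h2 : ∀ i, Nat.card (P i) ≤ Nat.card (P 0) := by
    intro i
    refine Nat.card_le_card_of_injective (fun q => (⟨(q.1.1 ∘ Equiv.swap 0 i,
      q.1.2 ∘ Equiv.swap 0 i), ?_⟩ : P 0)) ?_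
    · obtain ⟨⟨h, g⟩, hq1, hq2⟩ := q
      refine ⟨(hA _ _).2 hq1, ?_⟩
      rw [← hA (Equiv.swap 0 i)] at hq2
      convert hq2 using 2
      rw [Function.update_comp_equiv]
      simp
    · intro q q' h
      simp only [Subtype.mk.injEq, Prod.mk.injEq] at h
      exact Subtype.ext (Prod.ext ((Equiv.surjective _).injective_comp_right h.1)
        ((Equiv.surjective _).injective_comp_right h.2))
  -- The switching tuple is `(h 0, g 0, h 1, ..., h m)`; the remaining `m` entries of `g` are free.
  have h3 : Nat.card (P 0) ≤ Nat.card (switchingTuples A) * Fintype.card V ^ m := by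
    have : Fintype.card V ^ m = Nat.card (Fin m → V) := by simp
    rw [this, ← Nat.card_prod]
    refine Nat.card_le_card_of_injective (fun q => (⟨(Fin.cons (q.1.1 0)
      (Fin.cons (q.1.2 0) (Fin.tail q.1.1))), ?_⟩, Fin.tail q.1.2)) ?_
    · obtain ⟨⟨h, g⟩, hq1, hq2⟩ := q
      constructor
      · convert hq1 using 1
        ext i
        refine Fin.cases ?_ (fun i => ?_) i
        · simp
        · have : Fin.succAbove (1 : Fin (m + 2)) i.succ = i.succ.succ := by
            rw [← Fin.succ_zero_eq_one, Fin.succ_succAbove_succ, Fin.succAbove_zero]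
          simp [this, Fin.tail]
      · convert hq2 using 2
        ext i
        refine Fin.cases ?_ (fun i => ?_) i <;> simp [Fin.tail]
    · intro q q' h
      simp only [Prod.mk.injEq, Subtype.mk.injEq, Fin.cons_inj] at h
      obtain ⟨⟨a, b, c⟩, d⟩ := h
      refine Subtype.ext (Prod.ext ?_ ?_)
      · rw [← Fin.cons_self_tail q.1.1, ← Fin.cons_self_tail q'.1.1, a, c]
      · rw [← Fin.cons_self_tail q.1.2, ← Fin.cons_self_tail q'.1.2, b, d]
  calc _ ≤ ∑ i, Nat.card (P i) := h1
    _ ≤ ∑ _i : Fin (m + 1), Nat.card (P 0) := Finset.sum_le_sum fun i _ => h2 i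
    _ = (m + 1) * Nat.card (P 0) := by simp
    _ ≤ _ := Nat.mul_le_mul_left _ h3

/-! ### Sets versus enumerating tuples -/

/-- The `k`-tuples of elements of `X` that enumerate a member of `𝓔`. -/
def enumerations {α : Type*} (X : Set α) (k : ℕ) (𝓔 : Set (Set α)) : Set (Fin k → X) :=
  {t | Set.range (fun i => (t i : α)) ∈ 𝓔}

theorem injective_of_range_encard {α : Type*} {k : ℕ} (t : Fin k → α)
    (h : (Set.range t).encard = k) : Function.Injective t := by
  rw [← Set.image_univ] at h
  have : (Set.univ : Set (Fin k)).encard = k := by simp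
  exact Set.injOn_univ.1 ((Set.finite_univ).injOn_of_encard_image_eq (by rw [h, this]))

theorem exists_range_eq_of_encard {α : Type*} {k : ℕ} {S : Set α} (h : S.encard = k) :
    ∃ t : Fin k → α, Function.Injective t ∧ Set.range t = S := by
  have hf : S.Finite := Set.finite_of_encard_eq_coe h
  have := hf.fintype
  have hc : Fintype.card S = k := by
    rw [← Nat.card_eq_fintype_card, Nat.card_coe_set_eq, Set.ncard, h]; simp
  let e := (Fintype.equivFinOfCardEq hc).symm
  exact ⟨fun i => e i, Subtype.val_injective.comp e.injective, by
    ext x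
    constructor
    · rintro ⟨i, rfl⟩; exact (e i).2
    · intro hx; exact ⟨e.symm ⟨x, hx⟩, by simp⟩⟩

theorem finite_kSubsets {α : Type*} {X : Set α} (hX : X.Finite) (k : ℕ) :
    (Hypergraph.kSubsets X k).Finite :=
  hX.finite_subsets.subset fun _ he => he.1

theorem ncard_le_card_enumerations {α : Type*} {X : Set α} [Finite X] {k : ℕ} {𝓔 : Set (Set α)}
    (h : 𝓔 ⊆ Hypergraph.kSubsets X k) : 𝓔.ncard ≤ Nat.card (enumerations X k 𝓔) := by
  rw [← Nat.card_coe_set_eq]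
  refine Nat.card_le_card_of_surjective
    (fun t : enumerations X k 𝓔 => (⟨Set.range (fun i => (t.1 i : α)), t.2⟩ : 𝓔)) ?_
  rintro ⟨e, he⟩
  obtain ⟨t, -, ht⟩ := exists_range_eq_of_encard (h he).2
  have ht' : ∀ i, t i ∈ X := fun i => (h he).1 (ht ▸ ⟨i, rfl⟩)
  exact ⟨⟨fun i => ⟨t i, ht' i⟩, by simpa [enumerations, ht] using he⟩, Subtype.ext ht⟩

/-- Any enumeration of a set differs from a fixed one by a permutation of `Fin k`. -/
theorem card_enumerations_le {α : Type*} {X : Set α} [Finite X] {k : ℕ} {𝓔 : Set (Set α)}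
    (h : 𝓔 ⊆ Hypergraph.kSubsets X k) :
    Nat.card (enumerations X k 𝓔) ≤ 𝓔.ncard * k.factorial := by
  have hfin : Finite 𝓔 := (finite_kSubsets (Set.toFinite X) k).subset h
  have hp : k.factorial = Nat.card (Equiv.Perm (Fin k)) := by
    simp [Nat.card_eq_fintype_card, Fintype.card_perm]
  rw [← Nat.card_coe_set_eq, hp, ← Nat.card_prod]
  choose t ht htr using fun e : 𝓔 => exists_range_eq_of_encard (h e.2).2
  have hσ : ∀ x : enumerations X k 𝓔, ∃ σ : Equiv.Perm (Fin k),
      ∀ i, (x.1 i : α) = t ⟨_, x.2⟩ (σ i) := by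
    intro x
    have hmem : ∀ i, ∃ j, t ⟨_, x.2⟩ j = (x.1 i : α) := fun i => by
      have : (x.1 i : α) ∈ Set.range (t ⟨_, x.2⟩) := by rw [htr]; exact ⟨i, rfl⟩
      exact this
    choose σ hσ using hmem
    have hinj := injective_of_range_encard (fun i => (x.1 i : α)) (h x.2).2
    have : Function.Injective σ := fun i j hij => hinj (by
      change (x.1 i : α) = x.1 j
      rw [← hσ, ← hσ, hij])
    exact ⟨Equiv.ofBijective σ (Finite.injective_iff_bijective.1 this), fun i => (hσ i).symm⟩
  choose σ hσ using hσ
  refine Nat.card_le_card_of_injective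
    (fun x => ((⟨_, x.2⟩ : 𝓔), σ x)) ?_
  intro x y hxy
  simp only [Prod.mk.injEq] at hxy
  refine Subtype.ext (funext fun i => Subtype.ext ?_)
  rw [hσ x, hσ y, hxy.1, hxy.2]

/-! ### Counting bad arrays -/

/-- At most a `|B| / |V| ^ |κ|` fraction of all maps `ι → V` restrict along an injection
`q : κ → ι` to an element of `B`. -/
theorem card_restrict_mem_mul_le {V ι κ : Type*} [Fintype V] [Fintype ι] [Fintype κ]
    (q : κ → ι) (hq : Function.Injective q) (B : Set (κ → V)) :
    Nat.card {φ : ι → V | φ ∘ q ∈ B} * Fintype.card V ^ Fintype.card κ ≤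
      Nat.card B * Fintype.card V ^ Fintype.card ι := by
  classical
  have h1 : Nat.card {φ : ι → V | φ ∘ q ∈ B} ≤
      Nat.card B * Nat.card ({i // i ∉ Set.range q} → V) := by
    rw [← Nat.card_prod]
    refine Nat.card_le_card_of_injective (fun φ => (⟨φ.1 ∘ q, φ.2⟩, fun i => φ.1 i.1)) ?_
    intro φ ψ h
    simp only [Prod.mk.injEq, Subtype.mk.injEq] at h
    refine Subtype.ext (funext fun i => ?_)
    by_cases hi : i ∈ Set.range q
    · obtain ⟨j, rfl⟩ := hi
      exact congrFun h.1 j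
    · exact congrFun h.2 ⟨i, hi⟩
  have h2 : Fintype.card {i // i ∉ Set.range q} + Fintype.card κ = Fintype.card ι := by
    have h3 : Fintype.card {i // i ∈ Set.range q} = Fintype.card κ :=
      Set.card_range_of_injective hq
    have h4 := Fintype.card_subtype_le (fun i => i ∈ Set.range q)
    rw [Fintype.card_subtype_compl]
    omega
  refine (Nat.mul_le_mul_right _ h1).trans (le_of_eq ?_)
  rw [Nat.card_fun, Nat.card_eq_fintype_card (α := V),
    Nat.card_eq_fintype_card (α := {i // i ∉ Set.range q}), mul_assoc, ← pow_add, h2]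

/-- Union bound over pairs of indices: each coincidence is a restriction to the diagonal of `V ^ 2`,
of density `1 / |V|`. -/
theorem ncard_not_injective_mul_le (V ι : Type*) [Fintype V] [Nonempty V] [Fintype ι] :
    {φ : ι → V | ¬ Function.Injective φ}.ncard * Fintype.card V ≤
      Fintype.card ι ^ 2 * Fintype.card V ^ Fintype.card ι := by
  classical
  let B : Set (Fin 2 → V) := {t | t 0 = t 1}
  have hB : Nat.card B = Fintype.card V := by
    rw [← Nat.card_eq_fintype_card]
    refine Nat.card_congr ⟨fun t => t.1 0, fun v => ⟨fun _ => v, rfl⟩, ?_, fun _ => rfl⟩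
    rintro ⟨t, ht⟩
    refine Subtype.ext (funext fun i => ?_)
    fin_cases i
    · rfl
    · exact ht
  let P := {p : ι × ι // p.1 ≠ p.2}
  have hV : 0 < Fintype.card V := Fintype.card_pos
  have h1 : ∀ p : P, {φ : ι → V | φ ∘ ![p.1.1, p.1.2] ∈ B}.ncard * Fintype.card V ≤
      Fintype.card V ^ Fintype.card ι := by
    intro p
    have hq : Function.Injective ![p.1.1, p.1.2] := by
      intro i j hij
      have := p.2
      fin_cases i <;> fin_cases j <;> simp_all
    have h := card_restrict_mem_mul_le (V := V) _ hq B
    rw [hB, Fintype.card_fin, Nat.card_coe_set_eq] at h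
    refine Nat.le_of_mul_le_mul_left ?_ hV
    calc _ = _ := by ring
      _ ≤ _ := h
  have h2 : {φ : ι → V | ¬ Function.Injective φ} ⊆
      ⋃ p : P, {φ : ι → V | φ ∘ ![p.1.1, p.1.2] ∈ B} := by
    intro φ hφ
    simp only [Set.mem_ofPred_eq, Function.Injective, not_forall] at hφ
    obtain ⟨a, b, hab, hne⟩ := hφ
    exact Set.mem_iUnion.2 ⟨⟨(a, b), hne⟩, by simpa [B] using hab⟩
  have h3 : Fintype.card P ≤ Fintype.card ι ^ 2 := by
    rw [sq, ← Fintype.card_prod]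
    exact Fintype.card_subtype_le _
  calc _ ≤ (∑ p : P, {φ : ι → V | φ ∘ ![p.1.1, p.1.2] ∈ B}.ncard) * Fintype.card V :=
        Nat.mul_le_mul_right _ ((Set.ncard_le_ncard h2 (Set.toFinite _)).trans
          (Set.ncard_iUnion_le_of_fintype _))
    _ ≤ ∑ _p : P, Fintype.card V ^ Fintype.card ι := by
        rw [Finset.sum_mul]
        exact Finset.sum_le_sum fun p _ => h1 p
    _ = Fintype.card P * Fintype.card V ^ Fintype.card ι := by simp
    _ ≤ _ := Nat.mul_le_mul_right _ h3

/-- Union bound over the injections `q`. -/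
theorem ncard_exists_restrict_mem_mul_le {V ι κ : Type*} [Fintype V] [Fintype ι] [Fintype κ]
    (B : Set (κ → V)) :
    {φ : ι → V | ∃ q : κ → ι, Function.Injective q ∧ φ ∘ q ∈ B}.ncard *
        Fintype.card V ^ Fintype.card κ ≤
      Fintype.card ι ^ Fintype.card κ * (Nat.card B * Fintype.card V ^ Fintype.card ι) := by
  classical
  let P := {q : κ → ι // Function.Injective q}
  have h2 : {φ : ι → V | ∃ q : κ → ι, Function.Injective q ∧ φ ∘ q ∈ B} ⊆
      ⋃ q : P, {φ : ι → V | φ ∘ q.1 ∈ B} := by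
    rintro φ ⟨q, hq, h⟩
    exact Set.mem_iUnion.2 ⟨⟨q, hq⟩, h⟩
  have h3 : Fintype.card P ≤ Fintype.card ι ^ Fintype.card κ := by
    rw [← Fintype.card_fun]
    exact Fintype.card_subtype_le _
  calc _ ≤ (∑ q : P, {φ : ι → V | φ ∘ q.1 ∈ B}.ncard) * Fintype.card V ^ Fintype.card κ :=
        Nat.mul_le_mul_right _ ((Set.ncard_le_ncard h2 (Set.toFinite _)).trans
          (Set.ncard_iUnion_le_of_fintype _))
    _ ≤ ∑ _q : P, Nat.card B * Fintype.card V ^ Fintype.card ι := by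
        rw [Finset.sum_mul]
        refine Finset.sum_le_sum fun q _ => ?_
        rw [← Nat.card_coe_set_eq]
        exact card_restrict_mem_mul_le q.1 q.2 B
    _ = Fintype.card P * (Nat.card B * Fintype.card V ^ Fintype.card ι) := by simp
    _ ≤ _ := Nat.mul_le_mul_right _ h3

/-- If a symmetric set `A` of tuples and its complement are both dense and `B` is sparse, there is
an injective family of vertices all of whose transversals are switching tuples of `A`, and none of
whose injective subtuples lies in `B`. -/
theorem exists_injective_blowup (m M : ℕ) (δ : ℝ) (hδ : 0 < δ) :
    ∃ γ : ℝ, 0 < γ ∧ ∃ n₀ : ℕ, ∀ (V : Type*) [Fintype V], n₀ ≤ Fintype.card V →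
      ∀ A B : Set (Fin (m + 1) → V),
        (∀ (σ : Equiv.Perm (Fin (m + 1))) (x : Fin (m + 1) → V), x ∘ σ ∈ A ↔ x ∈ A) →
        δ * (Fintype.card V : ℝ) ^ (m + 1) ≤ Nat.card A →
        δ * (Fintype.card V : ℝ) ^ (m + 1) ≤ Nat.card (Aᶜ : Set (Fin (m + 1) → V)) →
        (Nat.card B : ℝ) ≤ γ * (Fintype.card V : ℝ) ^ (m + 1) →
        ∃ φ : Fin (m + 2) × Fin M → V, Function.Injective φ ∧
          (∀ f : Fin (m + 2) → Fin M, (fun i => φ (i, f i)) ∈ switchingTuples A) ∧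
          ∀ q : Fin (m + 1) → Fin (m + 2) × Fin M, Function.Injective q → φ ∘ q ∉ B := by
  classical
  set ι := Fin (m + 2) × Fin M with hι
  set N := Fintype.card ι with hN
  have hN' : N = (m + 2) * M := by simp [hN, hι]
  -- Switching tuples have density at least `δ ^ 2 / (m + 1)`, so `c` is the proportion of good
  -- arrays given by supersaturation.
  set c : ℝ := (δ ^ 2 / (m + 1)) ^ (M ^ (m + 2)) with hc
  have hc0 : 0 < c := by positivity
  set K : ℝ := (N : ℝ) ^ (m + 1) with hK
  have hK0 : 0 ≤ K := by positivity
  -- Each kind of bad array gets a budget of `c / 2`: `n₀` handles repetitions, with strict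
  -- inequality, and `γ` handles `B`. The `K + 1` in `γ` avoids dividing by zero when `M = 0`; `n₀ +
  -- 1` makes `V` nonempty.
  obtain ⟨n₀, hn₀⟩ := exists_nat_gt (2 * (N : ℝ) ^ 2 / c)
  refine ⟨c / (2 * (K + 1)), by positivity, n₀ + 1, ?_⟩
  intro V _ hn A B hA hA1 hA2 hB
  have hVpos : 0 < Fintype.card V := by omega
  have : Nonempty V := Fintype.card_pos_iff.1 hVpos
  set n : ℝ := (Fintype.card V : ℝ) with hnn
  have hn0 : 0 < n := by rw [hnn]; exact_mod_cast hVpos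
  have hbig : 2 * (N : ℝ) ^ 2 < c * n := by
    rw [div_lt_iff₀ hc0] at hn₀
    have : (n₀ : ℝ) ≤ n := by rw [hnn]; exact_mod_cast (by omega : n₀ ≤ Fintype.card V)
    nlinarith
  have hT : δ ^ 2 / (m + 1) * n ^ (m + 2) ≤ Nat.card (switchingTuples A) := by
    have h := card_mul_card_compl_le_switchingTuples A hA
    have h : (Nat.card A : ℝ) * Nat.card (Aᶜ : Set (Fin (m + 1) → V)) ≤
      (m + 1) * (Nat.card (switchingTuples A) * n ^ m) := by rw [hnn]; exact_mod_cast h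
    have h' := (mul_le_mul hA1 hA2 (by positivity) (by positivity)).trans h
    rw [div_mul_eq_mul_div, div_le_iff₀ (by positivity)]
    refine le_of_mul_le_mul_right ?_ (pow_pos hn0 m)
    calc _ = δ * n ^ (m + 1) * (δ * n ^ (m + 1)) := by ring
      _ ≤ _ := h'
      _ = _ := by ring
  let X : Set (ι → V) :=
    {φ | ∀ f : Fin (m + 2) → Fin M, (fun i => φ (i, f i)) ∈ switchingTuples A}
  have hX : c * n ^ N ≤ X.ncard := by
    have h := card_blowups_ge M (m + 2) (switchingTuples A) _ (by positivity) hT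
    rw [← hN'] at h
    refine h.trans (le_of_eq ?_)
    rw [← Nat.card_coe_set_eq]
    congr 1
    exact Nat.card_congr ((Equiv.curry _ _ _).symm.subtypeEquiv fun φ => Iff.rfl)
  have h1 : ({φ : ι → V | ¬ Function.Injective φ}.ncard : ℝ) < c / 2 * n ^ N := by
    have h := ncard_not_injective_mul_le V ι
    have h : ({φ : ι → V | ¬ Function.Injective φ}.ncard : ℝ) * n ≤ (N : ℝ) ^ 2 * n ^ N := by
      rw [hnn]; exact_mod_cast h
    refine lt_of_mul_lt_mul_right (h.trans_lt ?_) hn0.le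
    have := pow_pos hn0 N
    nlinarith
  have h2 : ({φ : ι → V | ∃ q : Fin (m + 1) → ι, Function.Injective q ∧ φ ∘ q ∈ B}.ncard : ℝ) ≤
      c / 2 * n ^ N := by
    have h := ncard_exists_restrict_mem_mul_le (V := V) (ι := ι) B
    rw [Fintype.card_fin] at h
    have h : ({φ : ι → V | ∃ q : Fin (m + 1) → ι, Function.Injective q ∧ φ ∘ q ∈ B}.ncard : ℝ) *
        n ^ (m + 1) ≤ K * (Nat.card B * n ^ N) := by
      rw [hnn, hK]; exact_mod_cast h
    refine le_of_mul_le_mul_right (h.trans ?_) (pow_pos hn0 (m + 1))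
    calc K * (Nat.card B * n ^ N) ≤ (K + 1) * (c / (2 * (K + 1)) * n ^ (m + 1) * n ^ N) := by
          gcongr
          linarith
      _ = _ := by field_simp
  by_contra hcon
  have hsub : X ⊆ {φ : ι → V | ¬ Function.Injective φ} ∪
      {φ : ι → V | ∃ q : Fin (m + 1) → ι, Function.Injective q ∧ φ ∘ q ∈ B} := by
    intro φ hφ
    by_contra hφ'
    rw [Set.mem_union, not_or] at hφ'
    refine hcon ⟨φ, not_not.1 hφ'.1, hφ, fun q hq hqB => hφ'.2 ⟨q, hq, hqB⟩⟩
  have h3 : (X.ncard : ℝ) ≤ _ :=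
    Nat.cast_le.2 ((Set.ncard_le_ncard hsub (Set.toFinite _)).trans (Set.ncard_union_le _ _))
  push_cast at h3
  linarith

/-! ### Ramsey on blocks -/

/-- Equal fibres give equal cumulative counts. If `g x < f x`, then `f ≤ g x` holds only at
positions before `x`, while `g ≤ g x` holds up to and including `x`. Used in both directions, this
shows that fibre sizes determine a monotone map. -/
theorem monotone_le_of_card_fiber_eq {k t : ℕ} {f g : Fin k → Fin t} (hf : Monotone f)
    (hg : Monotone g) (h : ∀ c, (Finset.univ.filter fun x => f x = c).card =
      (Finset.univ.filter fun x => g x = c).card) : f ≤ g := by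
  classical
  have hsum : ∀ (φ : Fin k → Fin t) (c : Fin t), (Finset.univ.filter fun x => φ x ≤ c).card =
      ∑ i ∈ Finset.Iic c, (Finset.univ.filter fun x => φ x = i).card := by
    intro φ c
    rw [Finset.card_eq_sum_card_fiberwise (f := φ) (t := Finset.Iic c)
      (fun x hx => by simpa using hx)]
    refine Finset.sum_congr rfl fun i hi => ?_
    congr 1
    ext x
    simp only [Finset.mem_filter, Finset.mem_univ, true_and, and_iff_right_iff_imp]
    rintro rfl
    exact Finset.mem_Iic.1 hi
  intro x
  by_contra! hx
  have h1 : (Finset.univ.filter fun y => f y ≤ g x).card =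
      (Finset.univ.filter fun y => g y ≤ g x).card := by
    rw [hsum, hsum]
    exact Finset.sum_congr rfl fun i _ => h i
  have h2 : (Finset.univ.filter fun y => f y ≤ g x) ⊆ Finset.Iio x := by
    intro y hy
    rw [Finset.mem_Iio]
    by_contra! hxy
    exact absurd ((hf hxy).trans (Finset.mem_filter.1 hy).2) hx.not_ge
  have h3 : Finset.Iic x ⊆ (Finset.univ.filter fun y => g y ≤ g x) := fun y hy => by
    simpa using hg (Finset.mem_Iic.1 hy)
  have h4 := Finset.card_le_card h2
  have h5 := Finset.card_le_card h3
  rw [Fin.card_Iio] at h4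
  rw [Fin.card_Iic] at h5
  omega

/-- Within sufficiently large blocks one finds blocks of size `s` on which membership of a `k`-set
in `𝓔` depends only on its intersection sizes with the blocks. -/
theorem exists_profile_blocks (k t s : ℕ) : ∃ M : ℕ, ∀ (α : Type*) (𝓔 : Set (Set α))
    (φ : Fin t × Fin M → α), Function.Injective φ →
      ∃ g : Fin t × Fin s → Fin M, (∀ i, Function.Injective fun j => g (i, j)) ∧
        ∀ S T : Set α, S.encard = k → T.encard = k →
          S ⊆ Set.range (fun p : Fin t × Fin s => φ (p.1, g p)) →
          T ⊆ Set.range (fun p : Fin t × Fin s => φ (p.1, g p)) →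
          (∀ i, (S ∩ Set.range fun j => φ (i, g (i, j))).encard =
            (T ∩ Set.range fun j => φ (i, g (i, j))).encard) → (S ∈ 𝓔 ↔ T ∈ 𝓔) := by
  classical
  obtain ⟨M, hM⟩ := finite_ramsey_orderEmbedding ((Fin k → Fin t) → Prop) k (t * s)
  refine ⟨M, fun α 𝓔 φ hφ => ?_⟩
  -- The colour of a `k`-set of positions records, for every assignment `f` of blocks to these
  -- positions, whether the resulting set lies in `𝓔`.
  obtain ⟨E, d, hd⟩ := hM fun u f => Set.range (fun i => φ (f i, u i)) ∈ 𝓔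
  -- Block `i` keeps only the `i`-th of `t` consecutive intervals of `s` positions. Listing a
  -- `k`-set by increasing position thus makes its block sequence monotone, hence determined by the
  -- intersection sizes.
  let b : Fin (t * s) → Fin t := fun u => (finProdFinEquiv.symm u).1
  have hb : Monotone b := fun u w huw => by
    exact Nat.div_le_div_right (c := s) (Fin.le_def.1 huw)
  let ψ : Fin (t * s) → α := fun u => φ (b u, E u)
  have hψ : Function.Injective ψ := fun u w h => E.injective (Prod.ext_iff.1 (hφ h)).2
  have hψv : ∀ p : Fin t × Fin s, φ (p.1, E (finProdFinEquiv p)) = ψ (finProdFinEquiv p) :=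
    fun p => by simp only [ψ, b, Equiv.symm_apply_apply]
  refine ⟨fun p => E (finProdFinEquiv p), fun i j j' h => ?_, ?_⟩
  · exact (Prod.ext_iff.1 (finProdFinEquiv.injective (E.injective h))).2
  have key : ∀ S : Set α, S.encard = k →
      S ⊆ Set.range (fun p : Fin t × Fin s => φ (p.1, E (finProdFinEquiv p))) →
      ∃ u : Fin k ↪o Fin (t * s), S = Set.range (fun x => ψ (u x)) ∧
        ∀ i, (S ∩ Set.range fun j => φ (i, E (finProdFinEquiv (i, j)))).encard =
          (Finset.univ.filter fun x => b (u x) = i).card := by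
    intro S hS hSr
    let S₀ := Finset.univ.filter fun u => ψ u ∈ S
    have hS₀ : ψ '' (S₀ : Set (Fin (t * s))) = S := by
      ext x
      constructor
      · rintro ⟨u, hu, rfl⟩
        simpa [S₀] using hu
      · intro hx
        obtain ⟨p, rfl⟩ := hSr hx
        exact ⟨finProdFinEquiv p, by simpa [S₀, ← hψv] using hx, (hψv p).symm⟩
    have hc : S₀.card = k := by
      rw [← hS₀, hψ.encard_image, Set.encard_coe_eq_coe_finsetCard] at hS
      exact_mod_cast hS
    have hSu : S = Set.range (fun x => ψ (S₀.orderEmbOfFin hc x)) := by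
      rw [← hS₀, ← Finset.range_orderEmbOfFin S₀ hc, ← Set.range_comp]
      rfl
    refine ⟨S₀.orderEmbOfFin hc, hSu, fun i => ?_⟩
    have hinj : Function.Injective (fun x => ψ (S₀.orderEmbOfFin hc x)) :=
      hψ.comp (S₀.orderEmbOfFin hc).injective
    rw [← Set.encard_coe_eq_coe_finsetCard, ← hinj.encard_image]
    congr 1
    ext x
    constructor
    · rintro ⟨hx, j, rfl⟩
      rw [hSu] at hx
      obtain ⟨y, hy⟩ := hx
      refine ⟨y, ?_, hy⟩
      have := (Prod.ext_iff.1 (hφ hy)).1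
      simpa using this
    · rintro ⟨y, hy, rfl⟩
      refine ⟨by rw [hSu]; exact ⟨y, rfl⟩, ?_⟩
      simp only [Finset.coe_filter, Finset.mem_univ, true_and, Set.mem_ofPred_eq] at hy
      refine ⟨(finProdFinEquiv.symm (S₀.orderEmbOfFin hc y)).2, ?_⟩
      have : (i, (finProdFinEquiv.symm (S₀.orderEmbOfFin hc y)).2) =
          finProdFinEquiv.symm (S₀.orderEmbOfFin hc y) := Prod.ext hy.symm rfl
      simp only [this, Equiv.apply_symm_apply, ψ, hy]
  intro S T hS hT hSr hTr hST
  obtain ⟨u, rfl, hu⟩ := key S hS hSr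
  obtain ⟨w, rfl, hw⟩ := key T hT hTr
  have hcard : ∀ i, (Finset.univ.filter fun x => b (u x) = i).card =
      (Finset.univ.filter fun x => b (w x) = i).card := fun i => by
    have := hST i
    rw [hu, hw] at this
    exact_mod_cast this
  have hbu : Monotone fun x => b (u x) := hb.comp u.monotone
  have hbw : Monotone fun x => b (w x) := hb.comp w.monotone
  have hbb : (fun x => b (u x)) = fun x => b (w x) :=
    le_antisymm (monotone_le_of_card_fiber_eq hbu hbw hcard)
      (monotone_le_of_card_fiber_eq hbw hbu fun i => (hcard i).symm)
  -- Both sets have colour `d`, evaluated here at their common block sequence.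
  have h := (congrFun (hd u) fun x => b (u x)).trans (congrFun (hd w) fun x => b (u x)).symm
  have h' : (Set.range (fun x => φ (b (u x), E (u x))) ∈ 𝓔) =
      (Set.range (fun x => φ (b (u x), E (w x))) ∈ 𝓔) := h
  have hbx : ∀ x, b (u x) = b (w x) := congrFun hbb
  rw [show (fun x => φ (b (u x), E (w x))) = fun x => ψ (w x) from
    funext fun x => by simp only [ψ, hbx]] at h'
  exact iff_of_eq h'

/-! ### Deleting a block -/

/-- The subhypergraph of `G` induced on `U`. -/
def Hypergraph.inducedOn {α : Type*} (G : Hypergraph α) (U : Set α) : Hypergraph α where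
  vertexSet := U
  edgeSet := {e | e ∈ G.edgeSet ∧ e ⊆ U}
  subset_vertexSet_of_mem_edgeSet' _ he := he.2

/-- Removing one of `t + 1` blocks on which membership depends only on profiles leaves a
`(k, t, s)`-pattern. -/
theorem isPattern_inducedOn_succAbove {α : Type*} {G : Hypergraph α} {k t s : ℕ} (hk : 2 ≤ k)
    (ht : 2 ≤ t) (hG : G.IsUniform k) (v : Fin (t + 1) × Fin s → α) (hv : Function.Injective v)
    (h : ∀ S T : Set α, S.encard = k → T.encard = k → S ⊆ Set.range v → T ⊆ Set.range v →
      (∀ i, (S ∩ Set.range fun j => v (i, j)).encard =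
        (T ∩ Set.range fun j => v (i, j)).encard) → (S ∈ G.edgeSet ↔ T ∈ G.edgeSet))
    (z : Fin (t + 1)) :
    (G.inducedOn (⋃ i, Set.range fun j => v (z.succAbove i, j))).IsPattern k t s := by
  have hdisj : ∀ i i', i ≠ i' →
      Disjoint (Set.range fun j => v (i, j)) (Set.range fun j => v (i', j)) := by
    intro i i' hne
    rw [Set.disjoint_left]
    rintro _ ⟨j, rfl⟩ ⟨j', hj'⟩
    exact hne (Prod.ext_iff.1 (hv hj')).1.symm
  have hsub : (⋃ i, Set.range fun j => v (z.succAbove i, j)) ⊆ Set.range v := by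
    refine Set.iUnion_subset fun i => ?_
    rintro _ ⟨j, rfl⟩
    exact ⟨_, rfl⟩
  have hz : ∀ S ⊆ (⋃ i, Set.range fun j => v (z.succAbove i, j)),
      S ∩ (Set.range fun j => v (z, j)) = ∅ := by
    intro S hS
    refine Set.disjoint_iff_inter_eq_empty.1 (Set.disjoint_of_subset_left hS ?_)
    exact Set.disjoint_iUnion_left.2 fun i => hdisj _ _ (Fin.succAbove_ne z i)
  refine ⟨hk, ht, fun e he => hG e he.1, fun i => Set.range fun j => v (z.succAbove i, j),
    fun i => ?_, fun i i' hne => hdisj _ _ fun h => hne (Fin.succAbove_right_injective h), rfl, ?_⟩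
  · have : Function.Injective fun j => v (z.succAbove i, j) :=
      fun j j' h => (Prod.ext_iff.1 (hv h)).2
    change (Set.range fun j => v (z.succAbove i, j)).encard = s
    rw [← Set.image_univ, this.encard_image]
    simp
  · rintro S ⟨hS, hSc⟩ T ⟨hT, hTc⟩ hST
    have := h S T hSc hTc (hS.trans hsub) (hT.trans hsub) fun i => by
      -- Neither set meets the deleted block, so their full profiles agree as well.
      rcases Fin.eq_self_or_eq_succAbove z i with rfl | ⟨i, rfl⟩
      · rw [hz S hS, hz T hT]
      · exact hST i
    exact ⟨fun h => ⟨this.1 h.1, hT⟩, fun h => ⟨this.2 h.1, hS⟩⟩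

/-- If some transversal of the blocks other than `1` is an edge and some transversal of the blocks
other than `0` is not, then leaving out block `1` or block `0` gives a non-homogeneous
hypergraph. -/
theorem exists_not_isHomogeneous {α : Type*} {G : Hypergraph α} {m s : ℕ} (hm : 1 ≤ m)
    (hs : 2 ≤ s) (v : Fin (m + 2) × Fin s → α) (hv : Function.Injective v) (j : Fin s)
    (h1 : Set.range (fun i => v (Fin.succAbove 1 i, j)) ∈ G.edgeSet)
    (h0 : Set.range (fun i => v (Fin.succAbove 0 i, j)) ∉ G.edgeSet) :
    ∃ z : Fin (m + 2), ¬ (G.inducedOn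
      (⋃ i, Set.range fun j => v (z.succAbove i, j))).IsHomogeneous (m + 1) := by
  by_contra! hcon
  have hcard : ∀ w : Fin (m + 1) → α, Function.Injective w →
      (Set.range w).encard = ((m + 1 : ℕ) : ℕ∞) := by
    intro w hw
    rw [← Set.image_univ, hw.encard_image]
    simp
  -- The `m` blocks other than 0 and 1 hold `m * s` vertices, enough for an `(m + 1)`-set `w` lying
  -- in both subhypergraphs.
  have hms : m + 1 ≤ m * s := by nlinarith
  let w : Fin (m + 1) → α := fun i =>
    v ((finProdFinEquiv.symm (Fin.castLE hms i)).1.succ.succ,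
      (finProdFinEquiv.symm (Fin.castLE hms i)).2)
  have hw : Function.Injective w := by
    intro i i' h
    have h' := Prod.ext_iff.1 (hv h)
    have := finProdFinEquiv.symm.injective
      (Prod.ext (Fin.succ_injective _ (Fin.succ_injective _ h'.1)) h'.2)
    exact Fin.castLE_injective hms this
  have hwz : ∀ z : Fin (m + 2), z = 0 ∨ z = 1 →
      Set.range w ⊆ ⋃ i, Set.range fun j => v (z.succAbove i, j) := by
    rintro z hz _ ⟨i, rfl⟩
    refine Set.mem_iUnion.2 ⟨(finProdFinEquiv.symm (Fin.castLE hms i)).1.succ,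
      (finProdFinEquiv.symm (Fin.castLE hms i)).2, ?_⟩
    rcases hz with rfl | rfl
    · simp [w]
    · simp only [w]
      rw [← Fin.succ_zero_eq_one, Fin.succ_succAbove_succ, Fin.succAbove_zero]
  have hsub : ∀ z : Fin (m + 2), Set.range (fun i => v (z.succAbove i, j)) ⊆
      ⋃ i, Set.range fun j => v (z.succAbove i, j) := by
    rintro z _ ⟨i, rfl⟩
    exact Set.mem_iUnion.2 ⟨i, j, rfl⟩
  have hE : Set.range w ∈ G.edgeSet := by
    rcases hcon 1 with h | h
    · exact (Set.eq_empty_iff_forall_notMem.1 h _ ⟨h1, hsub 1⟩).elim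
    · exact (h.ge ⟨hwz 1 (Or.inr rfl), hcard w hw⟩).1
  rcases hcon 0 with h | h
  · exact (Set.eq_empty_iff_forall_notMem.1 h _ ⟨hE, hwz 0 (Or.inl rfl)⟩).elim
  · refine h0 (h.ge ⟨hsub 0, hcard _ fun i i' h => ?_⟩).1
    exact Fin.succAbove_right_injective (p := 0) (Prod.ext_iff.1 (hv h)).1

/-! ### Main theorem -/

theorem mainTheorem8 (k s : ℕ) (hk : 2 ≤ k) (hs : 2 ≤ s) (δ : ℝ) (hδ : 0 < δ) :
    ∃ γ : ℝ, 0 < γ ∧ ∃ n₀ : ℕ, ∀ n : ℕ, n₀ ≤ n →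
      ∀ (α : Type*) (G : Hypergraph α) (W : Set (Set α)),
        G.vertexSet.encard = n →
        G.IsUniform k →
        δ * (n : ℝ) ^ k ≤
          min (G.edgeSet.ncard : ℝ) ((n.choose k : ℝ) - (G.edgeSet.ncard : ℝ)) →
        W ⊆ Hypergraph.kSubsets G.vertexSet k →
        (W.ncard : ℝ) ≤ γ * (n : ℝ) ^ k →
        ∃ F : Hypergraph α,
          F.IsInducedSubhypergraph G ∧ F.IsPattern k k s ∧ ¬ F.IsHomogeneous k ∧
            F.Avoids k W := by
  obtain ⟨m, rfl⟩ : ∃ m, k = m + 1 := ⟨k - 1, by omega⟩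
  obtain ⟨M, hM⟩ := exists_profile_blocks (m + 1) (m + 2) s
  obtain ⟨γ, hγ, n₀, hn₀⟩ := exists_injective_blowup m M δ hδ
  have hfac : (1 : ℝ) ≤ ((m + 1).factorial : ℝ) := by
    exact_mod_cast Nat.one_le_iff_ne_zero.2 (Nat.factorial_ne_zero _)
  -- Each member of `W` has at most `(m + 1)!` enumerations.
  refine ⟨γ / (m + 1).factorial, by positivity, n₀, ?_⟩
  intro n hn α G W hV hG hδG hW hWc
  have hfin : Finite G.vertexSet := Set.finite_of_encard_eq_coe hV
  have := Fintype.ofFinite G.vertexSet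
  have hcV : Fintype.card G.vertexSet = n := by
    rw [← Nat.card_eq_fintype_card, Nat.card_coe_set_eq, Set.ncard, hV]; simp
  have hGk : G.edgeSet ⊆ Hypergraph.kSubsets G.vertexSet (m + 1) :=
    fun e he => ⟨G.subset_vertexSet_of_mem_edgeSet he, hG e he⟩
  set A := enumerations G.vertexSet (m + 1) G.edgeSet with hAdef
  set B := enumerations G.vertexSet (m + 1) W with hBdef
  have hA1 : δ * (n : ℝ) ^ (m + 1) ≤ Nat.card A :=
    (hδG.trans (min_le_left _ _)).trans (by exact_mod_cast ncard_le_card_enumerations hGk)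
  -- Here `|Aᶜ| ≥ n ^ k - k! * e(G) ≥ k! * (n.choose k - e(G))` with `k = m + 1`; tuples with
  -- repeated entries only help.
  have hA2 : δ * (n : ℝ) ^ (m + 1) ≤ Nat.card (Aᶜ : Set (Fin (m + 1) → G.vertexSet)) := by
    have h1 : (Nat.card A : ℝ) ≤ G.edgeSet.ncard * (m + 1).factorial := by
      exact_mod_cast card_enumerations_le hGk
    have h2 : (Nat.card A : ℝ) + Nat.card (Aᶜ : Set (Fin (m + 1) → G.vertexSet)) =
        (n : ℝ) ^ (m + 1) := by
      have := Set.ncard_add_ncard_compl A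
      rw [Nat.card_fun, Nat.card_eq_fintype_card (α := G.vertexSet), hcV, Nat.card_fin] at this
      rw [Nat.card_coe_set_eq, Nat.card_coe_set_eq]
      exact_mod_cast this
    have h3 : (n.choose (m + 1) : ℝ) * (m + 1).factorial ≤ (n : ℝ) ^ (m + 1) := by
      have := Nat.descFactorial_le_pow n (m + 1)
      rw [Nat.descFactorial_eq_factorial_mul_choose, mul_comm] at this
      exact_mod_cast this
    have h4 := hδG.trans (min_le_right _ _)
    have h5 : 0 ≤ δ * (n : ℝ) ^ (m + 1) := by positivity
    nlinarith
  have hBc : (Nat.card B : ℝ) ≤ γ * (n : ℝ) ^ (m + 1) := by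
    have h1 : (Nat.card B : ℝ) ≤ W.ncard * (m + 1).factorial := by
      exact_mod_cast card_enumerations_le hW
    refine h1.trans ((mul_le_mul_of_nonneg_right hWc (by positivity)).trans (le_of_eq ?_))
    field_simp
  rw [← hcV] at hA1 hA2 hBc hn
  obtain ⟨φ, hφ, hφA, hφB⟩ := hn₀ G.vertexSet hn A B (fun σ x => by
    simp only [hAdef, enumerations, Set.mem_ofPred_eq]
    rw [← EquivLike.range_comp (fun i => (x i : α)) σ]
    rfl) hA1 hA2 hBc
  obtain ⟨g, hg, hgST⟩ := hM α G.edgeSet (fun p => (φ p : α)) (Subtype.val_injective.comp hφ)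
  let v : Fin (m + 2) × Fin s → α := fun p => φ (p.1, g p)
  have hv : Function.Injective v := by
    rintro ⟨i, j⟩ ⟨i', j'⟩ h
    have h' := Prod.ext_iff.1 (hφ (Subtype.val_injective h))
    obtain rfl : i = i' := h'.1
    rw [hg i h'.2]
  let j₀ : Fin s := ⟨0, by omega⟩
  have htr := hφA fun i => g (i, j₀)
  obtain ⟨z, hz⟩ := exists_not_isHomogeneous (G := G) (m := m) (by omega) hs v hv j₀ htr.1 htr.2
  refine ⟨_, ⟨?_, rfl⟩, isPattern_inducedOn_succAbove hk hk hG v hv hgST z, hz, ?_⟩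
  · refine Set.iUnion_subset fun i => ?_
    rintro _ ⟨j, rfl⟩
    exact (φ _).2
  · rw [Hypergraph.Avoids, Set.disjoint_left]
    rintro S ⟨hS, hSc⟩ hSW
    obtain ⟨t, ht, rfl⟩ := exists_range_eq_of_encard hSc
    have hq : ∀ i, ∃ p, (φ p : α) = t i := fun i => by
      obtain ⟨a, j, h⟩ := Set.mem_iUnion.1 (hS ⟨i, rfl⟩)
      exact ⟨_, h⟩
    choose q hq using hq
    -- An enumeration of a set in `W` inside the blocks would pull back to an injective subarray of
    -- `φ` in `B`.
    refine hφB q (fun i i' h => ht (by rw [← hq, ← hq, h])) ?_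
    simp only [hBdef, enumerations, Set.mem_ofPred_eq, Function.comp_apply, hq]
    exact hSW
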